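/- All metric spaces $X$ below have bounded geometry: for every $R>0$ there is $N$ with $|B(x;R)|\le N$ for all $x\in X$, where $B(x;R)=\{y: d(x,y)\le R\}$. Write $N_R(E)=\{y: d(y,E)\le R\}$ and $\partial_RE=N_R(E)\setminus E$. A probability measure $\mu$ on $X$ is a function $\mu:X\to[0,1]$ with $\sum_x\mu(x)=1$, and $\mu(E)=\sum_{x\in E}\mu(x)$; $\mathrm{Prob}(X)\subseteq\ell^1(X)$ is the set of these. Consider the following properties of $X$. - Property $A$: for all $R,\epsilon>0$ there are $S>0$ and $\xi:X\to\mathrm{Prob}(X)$, $x\mapsto\xi_x$, such that $\|\xi_x-\xi_y\|_1<\epsilon$ whenever $d(x,y)\le R$, and $\xi_x$ is supported in $B(x;S)$ for all $x$. - $ULA_\mu$: for all $R,\epsilon>0$ there is $S>0$ such that for every probability measure $\mu$ on $X$ there is a finite set $E\subseteq X$ with $\mathrm{diam}(E)\le S$ and $\mu(\partial_RE)<\epsilon\,\mu(E)$. - $ULA_\mu'$: for all $R,\epsilon>0$ there is $S>0$ such that for every probability measure $\mu$ on $X$ there is $\phi\in\ell^1(X)$ with $\mathrm{diam}(\mathrm{supp}\,\phi)\le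 S$ and $$\sum_{x\in\mathrm{supp}\,\mu}\mu(x)\sum_{y\in\mathrm{supp}\,\mu,\ d(x,y)\le R}|\phi(x)-\phi(y)|<\epsilon\sum_{x\in\mathrm{supp}\,\mu}\mu(x)|\phi(x)|.$$ - $MSP$ (metric sparsification): there is $c>0$ such that for all $R>0$ there is $S>0$ such that for every probability measure $\mu$ on $X$ there is a subset $\Omega=\bigsqcup_i\Omega_i$ of $X$ with $\mu(\Omega)\ge c$, $\mathrm{diam}(\Omega_i)\le S$ for all $i$, and $d(\Omega_i,\Omega_j)>R$ for all $i\ne j$. - $ONL$ (operator norm localisation): there is $c>0$ such that for all $R>0$ there is $S>0$ such that for every probability measure $\mu$ on $X$, every nonzero separable complex Hilbert space $H$ and every bounded operator $T=(T_{x,y})$ on $\ell^2(X,\mu,H)$ with $T_{x,y}=0$ whenever $d(x,y)>R$, there is a unit vector $\phi\in\ell^2(X,\mu,H)$ with $\mathrm{diam}(\mathrm{supp}\,\phi)\le S$ and $\|T\phi\|\ge c\|T\|$. Here $\ell^2(X,\mu,H)$ is the space of functions $\phi:X\to H$ with $\|\phi\|^2=\sum_x\mu(x)\|\phi(x)\|^2<\infty$,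 modulo functions of norm zero. Then for every bounded geometry metric space $X$: (i) $A\Rightarrow ULA_\mu$; (ii) $ULA_\mu\Leftrightarrow ULA_\mu'$; (iii) $ULA_\mu\Leftrightarrow MSP$; (iv) $MSP\Rightarrow ONL$; hence (v) $A\Rightarrow ONL$. In particular, (vi) every amenable (countable, discrete) group $G$, equipped with any proper left-invariant metric (i.e. one whose balls are finite), has $MSP$ and $ONL$. Amenable means the Følner condition: for every finite $K\subseteq G$ and $\epsilon>0$ there is a finite nonempty $F\subseteq G$ with $|kF\,\triangle\,F|\le\epsilon|F|$ for all $k\in K$. -/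

import Mathlib

open MeasureTheory
open scoped ENNReal Pointwise symmDiff

universe u v w

noncomputable section

namespace CoarseGeometry

/-- Bounded geometry: closed balls of radius `R` have uniformly bounded cardinality. -/
def BoundedGeometry (X : Type u) [MetricSpace X] : Prop :=
  ∀ R : ℝ, 0 < R → ∃ N : ℕ, ∀ x : X, (Metric.closedBall x R).encard ≤ N

/-- The statement `diam E ≤ S`, with the diameter taken in `[0, ∞]`. -/
def DiamLE {X : Type u} [MetricSpace X] (E : Set X) (S : ℝ) : Prop :=
  Metric.ediam E ≤ ENNReal.ofReal S

/-- The distance between two sets, `inf d(x, y)`, in `[0, ∞]`. -/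
def setDist {X : Type u} [MetricSpace X] (A B : Set X) : ℝ≥0∞ :=
  ⨅ x ∈ A, ⨅ y ∈ B, edist x y

/-- The `R`-boundary `∂_R E = N_R(E) \ E`, where `N_R(E) = {y | d(y, E) ≤ R}`. -/
def boundary {X : Type u} [MetricSpace X] (R : ℝ) (E : Set X) : Set X :=
  Metric.cthickening R E \ E

/-- The measure `μ(E)` of a subset `E`, for a probability measure `μ` on the discrete set `X`. -/
def mass {X : Type u} (μ : PMF X) (E : Set X) : ℝ :=
  (μ.toOuterMeasure E).toReal

/-- Property A. Elements of `Prob(X)` are probability mass functions, compared in `ℓ¹`-norm. -/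
def PropertyA (X : Type u) [MetricSpace X] : Prop :=
  ∀ R : ℝ, 0 < R → ∀ ε : ℝ, 0 < ε → ∃ S : ℝ, 0 < S ∧ ∃ ξ : X → PMF X,
    (∀ x y : X, dist x y ≤ R → ∑' z, |(ξ x z).toReal - (ξ y z).toReal| < ε) ∧
    (∀ x : X, (ξ x).support ⊆ Metric.closedBall x S)

/-- `ULA_μ`, in its formulation with sets. -/
def ULAmu (X : Type u) [MetricSpace X] : Prop :=
  ∀ R : ℝ, 0 < R → ∀ ε : ℝ, 0 < ε → ∃ S : ℝ, 0 < S ∧ ∀ μ : PMF X, ∃ E : Set X,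
    E.Finite ∧ DiamLE E S ∧ mass μ (boundary R E) < ε * mass μ E

/-- `ULA_μ`, in its formulation with functions. -/
def ULAmuFun (X : Type u) [MetricSpace X] : Prop :=
  ∀ R : ℝ, 0 < R → ∀ ε : ℝ, 0 < ε → ∃ S : ℝ, 0 < S ∧ ∀ μ : PMF X,
    ∃ φ : lp (fun _ : X => ℂ) 1,
      DiamLE (Function.support (φ : X → ℂ)) S ∧
      ∑' x : μ.support, (μ x).toReal *
          ∑' y : {y : X // y ∈ μ.support ∧ dist (x : X) y ≤ R}, ‖φ x - φ y‖
        < ε * ∑' x : μ.support, (μ x).toReal * ‖φ x‖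

/-- The metric sparsification property. The decomposition of `Ω` is given as the set `P` of its
pieces; distinct pieces are disjoint because they have positive distance. -/
def MSP (X : Type u) [MetricSpace X] : Prop :=
  ∃ c : ℝ, 0 < c ∧ ∀ R : ℝ, 0 < R → ∃ S : ℝ, 0 < S ∧ ∀ μ : PMF X,
    ∃ (Ω : Set X) (P : Set (Set X)), Ω = ⋃₀ P ∧ c ≤ mass μ Ω ∧
      (∀ A ∈ P, DiamLE A S) ∧
      (∀ A ∈ P, ∀ B ∈ P, A ≠ B → ENNReal.ofReal R < setDist A B)

/-- A probability mass function viewed as a measure on the σ-algebra of all subsets. -/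
def discreteMeasure {X : Type u} (μ : PMF X) : @Measure X ⊤ :=
  @PMF.toMeasure X ⊤ μ

/-- The Hilbert space `ℓ²(X, μ, H)`. -/
abbrev WeightedL2 {X : Type u} (μ : PMF X) (H : Type v) [NormedAddCommGroup H] :=
  Lp H 2 (discreteMeasure μ)

instance {X : Type u} (μ : PMF X) : @IsProbabilityMeasure X ⊤ (discreteMeasure μ) :=
  @PMF.toMeasure.isProbabilityMeasure X ⊤ μ

/-- The (class of the) function with value `h` at `y` and `0` elsewhere. -/
def pointFunction {X : Type u} (μ : PMF X) {H : Type v} [NormedAddCommGroup H]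
    (y : X) (h : H) : WeightedL2 μ H :=
  indicatorConstLp 2 (μ := discreteMeasure μ) (s := {y}) trivial
    (@measure_ne_top X ⊤ (discreteMeasure μ) _ {y}) h

/-- `T` has propagation at most `R`: its matrix entries `T_{x,y} : h ↦ (T (h at y)) (x)` vanish
when `d(x, y) > R`. The value at `x` of an element of `ℓ²(X, μ, H)` is meaningful exactly for the
points `x` of positive mass; if `y` has mass zero then the function `h at y` is zero. -/
def PropagationLE {X : Type u} [MetricSpace X] {μ : PMF X} {H : Type v}
    [NormedAddCommGroup H] [InnerProductSpace ℂ H]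
    (T : WeightedL2 μ H →L[ℂ] WeightedL2 μ H) (R : ℝ) : Prop :=
  ∀ x ∈ μ.support, ∀ y ∈ μ.support, R < dist x y →
    ∀ h : H, (T (pointFunction μ y h) : X → H) x = 0

/-- The support of an element of `ℓ²(X, μ, H)`. -/
def l2Support {X : Type u} {μ : PMF X} {H : Type v} [NormedAddCommGroup H]
    (φ : WeightedL2 μ H) : Set X :=
  {x | x ∈ μ.support ∧ (φ : X → H) x ≠ 0}

/-- The operator norm localisation property; `H` ranges over the nonzero separable complex
Hilbert spaces (of a given universe). -/
def ONL (X : Type u) [MetricSpace X] : Prop :=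
  ∃ c : ℝ, 0 < c ∧ ∀ R : ℝ, 0 < R → ∃ S : ℝ, 0 < S ∧
    ∀ (μ : PMF X) (H : Type v) [NormedAddCommGroup H] [InnerProductSpace ℂ H]
      [CompleteSpace H] [TopologicalSpace.SeparableSpace H] [Nontrivial H]
      (T : WeightedL2 μ H →L[ℂ] WeightedL2 μ H), PropagationLE T R →
      ∃ φ : WeightedL2 μ H, ‖φ‖ = 1 ∧ DiamLE (l2Support φ) S ∧ c * ‖T‖ ≤ ‖T φ‖

/-- Amenability of a discrete group (Følner condition). -/
def AmenableGroup (G : Type u) [Group G] : Prop :=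
  ∀ (K : Finset G) (ε : ℝ), 0 < ε → ∃ F : Finset G, F.Nonempty ∧
    ∀ k ∈ K, (((k • (F : Set G)) ∆ (F : Set G)).ncard : ℝ) ≤ ε * F.card

/-- A metric on a group is proper if balls (equivalently, balls about `1` for a left-invariant
metric) are finite. -/
def ProperGroupMetric (G : Type u) [Group G] [MetricSpace G] : Prop :=
  ∀ (g : G) (R : ℝ), (Metric.closedBall g R).Finite

end CoarseGeometry

end

/-!
As `μ(∂_R E) < ε μ(E)` means `μ(N_R E) < (1 + ε) μ(E)`, uniform local amenability asks for sets of
bounded diameter whose mass hardly grows under thickening. By the coarea formula, a function of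
small variation has a level set of this kind. Property A provides such a function: the average over
`z` of the variations of `x ↦ ξ_x(z)` is small, and the average of their norms is `1`.

Conversely, thickenings of the pieces of a sparse family are still disjoint. If the pieces carry a
proportion `c` of the mass, then some piece has at least `c` times the mass of its thickening; with
`n` steps of thickening and `(1 + ε)^n > 1 / c`, one of the steps is the required one. Applied to
the mass distribution of `T φ`, where `φ` almost attains the norm of `T`, the same pigeonhole
argument gives operator norm localisation. In the other direction, almost invariant sets chosen
greedily, each time removing the thickening of the chosen set, form a sparse family.
-/

namespace CoarseGeometry

section Weights

variable {X : Type u}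

theorem exists_finset_lt_tsum {w : X → ℝ≥0∞} {E : Set X} {b : ℝ≥0∞} (h : b < ∑' x : E, w x) :
    ∃ F : Finset X, ↑F ⊆ E ∧ b < ∑' x : (F : Set X), w x := by
  rw [ENNReal.tsum_eq_iSup_sum] at h
  obtain ⟨s, hs⟩ := lt_iSup_iff.1 h
  refine ⟨s.map (Function.Embedding.subtype _), by simp, ?_⟩
  rwa [Finset.tsum_subtype', Finset.sum_map]

theorem toOuterMeasure_eq_tsum (μ : PMF X) (E : Set X) : μ.toOuterMeasure E = ∑' x : E, μ x := by
  rw [PMF.toOuterMeasure_apply, tsum_subtype]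

theorem tsum_subtype_pmf_ne_top (μ : PMF X) (E : Set X) : ∑' x : E, μ x ≠ ∞ :=
  ((ENNReal.tsum_comp_le_tsum_of_injective Subtype.val_injective μ).trans_lt
    (μ.tsum_coe.trans_lt ENNReal.one_lt_top)).ne

theorem ofReal_mass (μ : PMF X) (E : Set X) : ENNReal.ofReal (mass μ E) = ∑' x : E, μ x := by
  rw [mass, toOuterMeasure_eq_tsum, ENNReal.ofReal_toReal (tsum_subtype_pmf_ne_top μ E)]

theorem mass_nonneg (μ : PMF X) (E : Set X) : 0 ≤ mass μ E :=
  ENNReal.toReal_nonneg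

theorem mass_lt_mul_mass_iff (μ : PMF X) {ε : ℝ} (hε : 0 ≤ ε) (A B : Set X) :
    mass μ A < ε * mass μ B ↔ ∑' x : A, μ x < ENNReal.ofReal ε * ∑' x : B, μ x := by
  rw [← ofReal_mass, ← ofReal_mass, ← ENNReal.ofReal_mul hε,
    ENNReal.ofReal_lt_ofReal_iff_of_nonneg (mass_nonneg μ A)]

theorem le_mass_iff (μ : PMF X) {c : ℝ} (E : Set X) :
    c ≤ mass μ E ↔ ENNReal.ofReal c ≤ ∑' x : E, μ x := by
  rw [← ofReal_mass, ENNReal.ofReal_le_ofReal_iff (mass_nonneg μ E)]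

theorem tsum_mul_le_of_le (μ : PMF X) {g : X → ℝ≥0∞} {C : ℝ≥0∞} (h : ∀ x, g x ≤ C) :
    ∑' x, μ x * g x ≤ C :=
  calc ∑' x, μ x * g x ≤ ∑' x, μ x * C := ENNReal.tsum_le_tsum fun x => by gcongr; exact h x
    _ = C := by rw [ENNReal.tsum_mul_right, μ.tsum_coe, one_mul]

theorem tsum_subtype_normalize (w : X → ℝ≥0∞) (h₀ : ∑' x, w x ≠ 0) (h : ∑' x, w x ≠ ∞)
    (E : Set X) : ∑' x : E, PMF.normalize w h₀ h x = (∑' x : E, w x) * (∑' x, w x)⁻¹ := by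
  simp only [PMF.normalize_apply, ENNReal.tsum_mul_right]

theorem tsum_subtype_indicator (w : X → ℝ≥0∞) (F E : Set X) :
    ∑' x : E, F.indicator w x = ∑' x : (F ∩ E : Set X), w x := by
  rw [tsum_subtype, tsum_subtype, Set.inter_comm, Set.indicator_indicator]

end Weights

section Metric

variable {X : Type u} [MetricSpace X]

theorem DiamLE.mono {E F : Set X} {S T : ℝ} (hE : DiamLE E S) (hF : F ⊆ E) (hST : S ≤ T) :
    DiamLE F T :=
  (Metric.ediam_mono hF).trans (hE.trans (ENNReal.ofReal_le_ofReal hST))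

theorem DiamLE.dist_le {E : Set X} {S : ℝ} (hE : DiamLE E S) (hS : 0 ≤ S) {x y : X} (hx : x ∈ E)
    (hy : y ∈ E) : dist x y ≤ S :=
  (edist_le_ofReal hS).1 (Metric.ediam_le_iff.1 hE x hx y hy)

theorem diamLE_closedBall (x : X) {R : ℝ} (hR : 0 ≤ R) :
    DiamLE (Metric.closedBall x R) (2 * R) := by
  refine Metric.ediam_le fun y hy z hz => (edist_le_ofReal (by positivity)).2 ?_
  linarith [dist_triangle_right y z x, Metric.mem_closedBall.1 hy, Metric.mem_closedBall.1 hz]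

theorem DiamLE.cthickening {E : Set X} {S R : ℝ} (hE : DiamLE E S) (hS : 0 ≤ S) (hR : 0 ≤ R) :
    DiamLE (Metric.cthickening R E) (S + 2 * R) := by
  lift R to NNReal using hR
  refine (Metric.ediam_cthickening_le R).trans ?_
  rw [ENNReal.ofReal_add hS (by positivity), ENNReal.ofReal_mul zero_le_two,
    ENNReal.ofReal_ofNat, ENNReal.ofReal_coe_nnreal]
  gcongr
  exact hE

theorem BoundedGeometry.finite_closedBall (hX : BoundedGeometry X) (x : X) (R : ℝ) :
    (Metric.closedBall x R).Finite := by
  obtain ⟨N, hN⟩ := hX (max R 1) (by positivity)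
  exact (Set.finite_of_encard_le_coe (hN x)).subset
    (Metric.closedBall_subset_closedBall (le_max_left R 1))

theorem DiamLE.finite {E : Set X} {S : ℝ} (hE : DiamLE E S) (hS : 0 ≤ S)
    (hX : BoundedGeometry X) : E.Finite := by
  rcases E.eq_empty_or_nonempty with rfl | ⟨x, hx⟩
  · exact Set.finite_empty
  · exact (hX.finite_closedBall x S).subset fun y hy => hE.dist_le hS hy hx

theorem lt_dist_of_lt_setDist {A B : Set X} {R : ℝ} (h : ENNReal.ofReal R < setDist A B)
    {x y : X} (hx : x ∈ A) (hy : y ∈ B) : R < dist x y := by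
  have h_edist : ENNReal.ofReal R < edist x y :=
    h.trans_le (iInf₂_le_of_le x hx (iInf₂_le y hy))
  rw [edist_dist] at h_edist
  exact ((ENNReal.ofReal_lt_ofReal_iff').1 h_edist).1

theorem ofReal_le_setDist {A B : Set X} {R : ℝ} (h : ∀ x ∈ A, ∀ y ∈ B, R ≤ dist x y) :
    ENNReal.ofReal R ≤ setDist A B := by
  refine le_iInf₂ fun x hx => le_iInf₂ fun y hy => ?_
  rw [edist_dist]
  exact ENNReal.ofReal_le_ofReal (h x hx y hy)

theorem iUnion_closedBall_subset_cthickening (R : ℝ) (E : Set X) :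
    ⋃ x ∈ E, Metric.closedBall x R ⊆ Metric.cthickening R E :=
  Set.iUnion₂_subset fun _ hx => Metric.closedBall_subset_cthickening hx R

end Metric

section LocalAmenability

variable {X : Type u} [MetricSpace X]

theorem mass_boundary_lt_iff (μ : PMF X) {ε : ℝ} (hε : 0 ≤ ε) (R : ℝ) (E : Set X) :
    mass μ (boundary R E) < ε * mass μ E ↔
      ∑' x : Metric.cthickening R E, μ x < (1 + ENNReal.ofReal ε) * ∑' x : E, μ x := by
  have h_union : ∑' x : Metric.cthickening R E, μ x
      = (∑' x : E, μ x) + ∑' x : boundary R E, μ x := by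
    rw [boundary, ← ENNReal.summable.tsum_union_disjoint Set.disjoint_sdiff_right
      ENNReal.summable, Set.union_sdiff_cancel (Metric.self_subset_cthickening E)]
  rw [mass_lt_mul_mass_iff μ hε, h_union, one_add_mul,
    ENNReal.add_lt_add_iff_left (tsum_subtype_pmf_ne_top μ E)]

theorem ULAmu.exists_tsum_cthickening_lt (h : ULAmu X) {R ε : ℝ} (hR : 0 < R) (hε : 0 < ε) :
    ∃ S : ℝ, 0 < S ∧ ∀ w : X → ℝ≥0∞, ∑' x, w x ≠ 0 → ∑' x, w x ≠ ∞ → ∃ E : Set X,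
      DiamLE E S ∧
        ∑' x : Metric.cthickening R E, w x < (1 + ENNReal.ofReal ε) * ∑' x : E, w x := by
  obtain ⟨S, hS, hμ⟩ := h R hR ε hε
  refine ⟨S, hS, fun w hw₀ hw => ?_⟩
  obtain ⟨E, -, hE, hlt⟩ := hμ (PMF.normalize w hw₀ hw)
  rw [mass_boundary_lt_iff _ hε.le, tsum_subtype_normalize, tsum_subtype_normalize,
    ← mul_assoc] at hlt
  exact ⟨E, hE, lt_of_mul_lt_mul_right' hlt⟩

/-- Truncating `E` to a finite subset keeps the inequality, and for finite sets the thickening is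
the union of closed balls. -/
theorem ulamu_of_forall_exists (h : ∀ R : ℝ, 0 < R → ∀ ε : ℝ, 0 < ε → ∃ S : ℝ, 0 < S ∧
    ∀ μ : PMF X, ∃ E : Set X, DiamLE E S ∧
      ∑' x : ⋃ x ∈ E, Metric.closedBall x R, μ x < (1 + ENNReal.ofReal ε) * ∑' x : E, μ x) :
    ULAmu X := by
  intro R hR ε hε
  obtain ⟨S, hS, hμ⟩ := h R hR ε hε
  refine ⟨S, hS, fun μ => ?_⟩
  obtain ⟨E, hE, hlt⟩ := hμ μ
  have hε₀ : 1 + ENNReal.ofReal ε ≠ 0 := by simp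
  have hε_top : 1 + ENNReal.ofReal ε ≠ ∞ := by simp
  rw [mul_comm, ← ENNReal.div_lt_iff (.inl hε₀) (.inl hε_top)] at hlt
  obtain ⟨F, hFE, hF⟩ := exists_finset_lt_tsum hlt
  refine ⟨F, F.finite_toSet, hE.mono hFE le_rfl, (mass_boundary_lt_iff μ hε.le R F).2 ?_⟩
  rw [ENNReal.div_lt_iff (.inl hε₀) (.inl hε_top), mul_comm] at hF
  rw [F.finite_toSet.isCompact.cthickening_eq_biUnion_closedBall hR.le]
  exact (ENNReal.tsum_mono_subtype μ (Set.biUnion_mono hFE fun _ _ => subset_rfl)).trans_lt hF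

end LocalAmenability

section SparseFamilies

variable {X : Type u} [MetricSpace X]

/-- A family of sets of diameter at most `S`, distinct members of which are more than `R` apart:
the kind of decomposition that metric sparsification asks for. The separation is stated for
points, so for infinite members the infimum of the distances may be equal to `R`. -/
structure IsSparse (P : Set (Set X)) (R S : ℝ) : Prop where
  diamLE : ∀ A ∈ P, DiamLE A S
  lt_dist : ∀ A ∈ P, ∀ B ∈ P, A ≠ B → ∀ x ∈ A, ∀ y ∈ B, R < dist x y

theorem IsSparse.empty (R S : ℝ) : IsSparse (∅ : Set (Set X)) R S :=
  ⟨by simp, by simp⟩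

theorem IsSparse.insert {P : Set (Set X)} {R S : ℝ} (hP : IsSparse P R S) {E : Set X}
    (hE : DiamLE E S) (h : ∀ A ∈ P, ∀ x ∈ E, ∀ y ∈ A, R < dist x y) :
    IsSparse (insert E P) R S where
  diamLE := Set.forall_mem_insert.2 ⟨hE, hP.diamLE⟩
  lt_dist := by
    rintro A (rfl | hA) B (rfl | hB) hAB x hx y hy
    · exact (hAB rfl).elim
    · exact h B hB x hx y hy
    · exact dist_comm x y ▸ h A hA y hy x hx
    · exact hP.lt_dist A hA B hB hAB x hx y hy

theorem IsSparse.disjoint_cthickening {P : Set (Set X)} {R S T : ℝ} (hP : IsSparse P R S)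
    (hT : 0 ≤ T) (hTR : 2 * T < R) {A B : Set X} (hA : A ∈ P) (hB : B ∈ P) (hAB : A ≠ B) :
    Disjoint (Metric.cthickening T A) (Metric.cthickening T B) := by
  rw [Set.disjoint_left]
  intro x hxA hxB
  have h_subset : ∀ E : Set X, Metric.cthickening T E ⊆ Metric.thickening (R / 2) E :=
    Metric.cthickening_subset_thickening' (by linarith) (by linarith)
  obtain ⟨a, ha, hxa⟩ := Metric.mem_thickening_iff.1 (h_subset A hxA)
  obtain ⟨b, hb, hxb⟩ := Metric.mem_thickening_iff.1 (h_subset B hxB)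
  linarith [hP.lt_dist A hA B hB hAB a ha b hb, dist_triangle_left a b x]

theorem IsSparse.exists_tsum_cthickening_lt {P : Set (Set X)} {R S T : ℝ} (hP : IsSparse P R S)
    (hT : 0 ≤ T) (hTR : 2 * T < R) {f g : X → ℝ≥0∞} (h : ∑' x, g x < ∑' x : ⋃₀ P, f x) :
    ∃ A ∈ P, ∑' x : Metric.cthickening T A, g x < ∑' x : A, f x := by
  by_contra! h_le
  refine h.not_ge ?_
  calc ∑' x : ⋃₀ P, f x
      = ∑' x : ⋃ A ∈ P, A, f x := by rw [Set.sUnion_eq_biUnion]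
    _ ≤ ∑' A : P, ∑' x : (A : Set X), f x := ENNReal.tsum_biUnion_le_tsum f P fun A => A
    _ ≤ ∑' A : P, ∑' x : Metric.cthickening T (A : Set X), g x :=
        ENNReal.tsum_le_tsum fun A => h_le A A.2
    _ = ∑' x : ⋃ A ∈ P, Metric.cthickening T A, g x :=
        (ENNReal.tsum_biUnion' fun A hA B hB hAB =>
          hP.disjoint_cthickening hT hTR hA hB hAB).symm
    _ ≤ ∑' x, g x := ENNReal.tsum_comp_le_tsum_of_injective Subtype.val_injective g

theorem MSP.exists_isSparse (h : MSP X) :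
    ∃ c : ℝ, 0 < c ∧ ∀ R : ℝ, 0 < R → ∃ S : ℝ, 0 < S ∧
      ∀ w : X → ℝ≥0∞, ∑' x, w x ≠ 0 → ∑' x, w x ≠ ∞ → ∃ P : Set (Set X), IsSparse P R S ∧
        ENNReal.ofReal c * ∑' x, w x ≤ ∑' x : ⋃₀ P, w x := by
  obtain ⟨c, hc, h⟩ := h
  refine ⟨c, hc, fun R hR => ?_⟩
  obtain ⟨S, hS, hμ⟩ := h R hR
  refine ⟨S, hS, fun w hw₀ hw => ?_⟩
  obtain ⟨_, P, rfl, hle, hdiam, hdist⟩ := hμ (PMF.normalize w hw₀ hw)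
  rw [le_mass_iff, tsum_subtype_normalize, ← div_eq_mul_inv] at hle
  exact ⟨P, ⟨hdiam, fun A hA B hB hAB x hx y hy =>
    lt_dist_of_lt_setDist (hdist A hA B hB hAB) hx hy⟩, ENNReal.mul_le_of_le_div hle⟩

theorem msp_of_exists_isSparse {c : ℝ} (hc : 0 < c) (h : ∀ R : ℝ, 0 < R → ∃ S : ℝ, 0 < S ∧
    ∀ μ : PMF X, ∃ P : Set (Set X), IsSparse P R S ∧ ENNReal.ofReal c ≤ ∑' x : ⋃₀ P, μ x) :
    MSP X := by
  refine ⟨c, hc, fun R hR => ?_⟩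
  obtain ⟨S, hS, hμ⟩ := h (R + 1) (by positivity)
  refine ⟨S, hS, fun μ => ?_⟩
  obtain ⟨P, hP, hle⟩ := hμ μ
  refine ⟨⋃₀ P, P, rfl, (le_mass_iff μ _).2 hle, hP.diamLE, fun A hA B hB hAB => ?_⟩
  have h_lt : ENNReal.ofReal R < ENNReal.ofReal (R + 1) :=
    (ENNReal.ofReal_lt_ofReal_iff (by positivity)).2 (lt_add_one R)
  exact h_lt.trans_le
    (ofReal_le_setDist fun x hx y hy => (hP.lt_dist A hA B hB hAB x hx y hy).le)

end SparseFamilies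

section SparsificationIffAmenability

variable {X : Type u} [MetricSpace X]

theorem exists_succ_lt_mul_of_lt_pow_mul {u : ℕ → ℝ≥0∞} {a : ℝ≥0∞} {n : ℕ}
    (h : u n < a ^ n * u 0) : ∃ k < n, u (k + 1) < a * u k := by
  by_contra! h_le
  have h_pow : ∀ k ≤ n, a ^ k * u 0 ≤ u k := by
    intro k
    induction k with
    | zero => simp
    | succ k ih =>
      intro hk
      calc a ^ (k + 1) * u 0 = a * (a ^ k * u 0) := by rw [pow_succ', mul_assoc]
        _ ≤ a * u k := by gcongr; exact ih (by lia)
        _ ≤ u (k + 1) := h_le k hk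
  exact h.not_ge (h_pow n le_rfl)

theorem exists_one_lt_pow_mul {a c : ℝ≥0∞} (ha : 1 < a) (hc : c ≠ 0) : ∃ n : ℕ, 1 < a ^ n * c := by
  have h_tendsto : Filter.Tendsto (fun n : ℕ => a ^ n * c) Filter.atTop (nhds ∞) := by
    rw [← ENNReal.top_mul hc]
    exact ENNReal.Tendsto.mul_const (ENNReal.tendsto_pow_atTop_nhds_top_iff.2 ha)
      (.inl ENNReal.top_ne_zero)
  exact (h_tendsto.eventually_const_lt ENNReal.one_lt_top).exists

/-- The `n`-fold thickenings of the pieces are disjoint, so one of them has mass less than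
`(1 + ε) ^ n` times that of its piece; hence one of the `n` steps of thickening multiplies the
mass by less than `1 + ε`. -/
theorem MSP.ulamu (h : MSP X) : ULAmu X := by
  refine ulamu_of_forall_exists fun R hR ε hε => ?_
  obtain ⟨c, hc, h⟩ := h.exists_isSparse
  set a := 1 + ENNReal.ofReal ε
  have ha : 1 < a := ENNReal.lt_add_right ENNReal.one_ne_top (by simpa using hε)
  obtain ⟨n, hn⟩ := exists_one_lt_pow_mul ha (c := ENNReal.ofReal c) (by simpa using hc)
  obtain ⟨S, hS, h⟩ := h (2 * (n * R) + R) (by positivity)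
  refine ⟨S + 2 * (n * R), by positivity, fun μ => ?_⟩
  obtain ⟨P, hP, hle⟩ := h μ (by simp) (by simp)
  have h_mass : ∑' x, μ x < ∑' x : ⋃₀ P, a ^ n * μ x := by
    rw [μ.tsum_coe, mul_one] at hle
    rw [μ.tsum_coe, ENNReal.tsum_mul_left]
    exact hn.trans_le (by gcongr)
  obtain ⟨A, hA, hlt⟩ := hP.exists_tsum_cthickening_lt (f := fun x => a ^ n * μ x) (g := μ)
    (T := n * R) (by positivity) (by linarith) h_mass
  obtain ⟨k, hk, hlt⟩ := exists_succ_lt_mul_of_lt_pow_mul (a := a) (n := n)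
    (u := fun k => ∑' x : Metric.cthickening (k * R) A, μ x) (hlt.trans_le (by
      rw [ENNReal.tsum_mul_left]
      gcongr
      exact ENNReal.tsum_mono_subtype μ (Metric.self_subset_cthickening A)))
  refine ⟨Metric.cthickening (k * R) A, ((hP.diamLE A hA).cthickening hS.le (by positivity)).mono
    subset_rfl (by gcongr), (ENNReal.tsum_mono_subtype μ ?_).trans_lt hlt⟩
  calc ⋃ x ∈ Metric.cthickening (k * R) A, Metric.closedBall x R
      ⊆ Metric.cthickening R (Metric.cthickening (k * R) A) :=
        iUnion_closedBall_subset_cthickening R _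
    _ ⊆ Metric.cthickening (R + k * R) A :=
        Metric.cthickening_cthickening_subset hR.le (by positivity) A
    _ = Metric.cthickening ((k + 1 : ℕ) * R) A := by push_cast; congr 1; ring

/-- Greedy choice: `E` is kept and the search goes on in the complement of its thickening. -/
theorem exists_isSparse_of_finset {w : X → ℝ≥0∞} {C : ℝ≥0∞} {R S : ℝ}
    (h : ∀ F : Finset X, ∑' x : (F : Set X), w x ≠ 0 → ∃ E : Set X, E ⊆ F ∧ E.Nonempty ∧
      DiamLE E S ∧ ∑' x : (F ∩ Metric.cthickening R E : Set X), w x ≤ C * ∑' x : E, w x)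
    (F : Finset X) :
    ∃ P : Set (Set X), IsSparse P R S ∧ (∀ A ∈ P, A ⊆ F) ∧
      ∑' x : (F : Set X), w x ≤ C * ∑' x : ⋃₀ P, w x := by
  classical
  induction F using Finset.strongInduction with
  | H F ih =>
  by_cases hF : ∑' x : (F : Set X), w x = 0
  · exact ⟨∅, .empty R S, by simp, hF.le.trans zero_le⟩
  obtain ⟨E, hEF, ⟨e, he⟩, hE, hle⟩ := h F hF
  set F' := F.filter (· ∉ Metric.cthickening R E) with hF'
  have hF'_ssubset : F' ⊂ F := Finset.filter_ssubset.2
    ⟨e, hEF he, not_not.2 (Metric.self_subset_cthickening E he)⟩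
  obtain ⟨P, hP, hPF', hP_le⟩ := ih F' hF'_ssubset
  have h_notMem {A : Set X} (hA : A ∈ P) {y : X} (hy : y ∈ A) : y ∉ Metric.cthickening R E :=
    (Finset.mem_filter.1 (hPF' A hA hy)).2
  have h_disj : Disjoint E (⋃₀ P) := Set.disjoint_sUnion_right.2 fun A hA =>
    Set.disjoint_right.2 fun y hy hyE => h_notMem hA hy (Metric.self_subset_cthickening E hyE)
  refine ⟨insert E P, hP.insert hE fun A hA x hx y hy => ?_, ?_, ?_⟩
  · rw [dist_comm]
    exact lt_of_not_ge fun hle => h_notMem hA hy (Metric.mem_cthickening_of_dist_le y x R E hx hle)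
  · exact Set.forall_mem_insert.2 ⟨hEF, fun A hA =>
      (hPF' A hA).trans (Finset.coe_subset.2 hF'_ssubset.subset)⟩
  · have hF_union : (F : Set X) = ↑F ∩ Metric.cthickening R E ∪ F' := by
      rw [hF', Finset.coe_filter]
      exact (Set.inter_union_sdiff _ _).symm
    calc ∑' x : (F : Set X), w x
        = ∑' x : (↑F ∩ Metric.cthickening R E ∪ ↑F' : Set X), w x := by rw [← hF_union]
      _ ≤ (∑' x : (F ∩ Metric.cthickening R E : Set X), w x) + ∑' x : (F' : Set X), w x :=
          ENNReal.tsum_union_le w _ _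
      _ ≤ C * (∑' x : E, w x) + C * ∑' x : ⋃₀ P, w x := add_le_add hle hP_le
      _ = C * ∑' x : ⋃₀ insert E P, w x := by
          rw [Set.sUnion_insert, ← mul_add,
            ENNReal.summable.tsum_union_disjoint h_disj ENNReal.summable]

theorem ULAmu.exists_subset_finset (h : ULAmu X) {R ε : ℝ} (hR : 0 < R) (hε : 0 < ε) :
    ∃ S : ℝ, 0 < S ∧ ∀ (μ : PMF X) (F : Finset X), ∑' x : (F : Set X), μ x ≠ 0 → ∃ E : Set X,
      E ⊆ F ∧ E.Nonempty ∧ DiamLE E S ∧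
      ∑' x : (F ∩ Metric.cthickening R E : Set X), μ x
        ≤ (1 + ENNReal.ofReal ε) * ∑' x : E, μ x := by
  obtain ⟨S, hS, h⟩ := h.exists_tsum_cthickening_lt hR hε
  refine ⟨S, hS, fun μ F hF => ?_⟩
  have h_tsum : ∑' x, (F : Set X).indicator μ x = ∑' x : (F : Set X), μ x :=
    (tsum_subtype _ _).symm
  obtain ⟨E, hE, hlt⟩ := h ((F : Set X).indicator μ) (h_tsum ▸ hF)
    (h_tsum ▸ tsum_subtype_pmf_ne_top μ F)
  simp only [tsum_subtype_indicator] at hlt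
  refine ⟨F ∩ E, Set.inter_subset_left, ?_, hE.mono Set.inter_subset_right le_rfl, ?_⟩
  · by_contra h_empty
    simp [Set.not_nonempty_iff_eq_empty.1 h_empty] at hlt
  · refine (ENNReal.tsum_mono_subtype μ ?_).trans hlt.le
    exact Set.inter_subset_inter_right _
      (Metric.cthickening_subset_of_subset R Set.inter_subset_right)

theorem ULAmu.msp (h : ULAmu X) : MSP X := by
  refine msp_of_exists_isSparse (c := 1 / 4) (by norm_num) fun R hR => ?_
  obtain ⟨S, hS, h⟩ := h.exists_subset_finset hR one_pos
  refine ⟨S, hS, fun μ => ?_⟩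
  obtain ⟨F, -, hF⟩ := exists_finset_lt_tsum (w := μ) (E := Set.univ) (b := 2⁻¹) (by
    rw [tsum_univ, μ.tsum_coe]
    exact ENNReal.one_half_lt_one)
  obtain ⟨P, hP, -, hle⟩ := exists_isSparse_of_finset (h μ) F
  have h_quarter : ENNReal.ofReal (1 / 4) = 2⁻¹ / 2 := by
    rw [← ENNReal.ofReal_ofNat, ← ENNReal.ofReal_inv_of_pos two_pos,
      ← ENNReal.ofReal_div_of_pos two_pos]
    norm_num
  refine ⟨P, hP, h_quarter ▸ ENNReal.div_le_of_le_mul' (hF.le.trans (hle.trans_eq ?_))⟩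
  rw [ENNReal.ofReal_one, one_add_one_eq_two]

end SparsificationIffAmenability

section LevelSets

theorem volume_setOf_ofReal_lt (c : ℝ≥0∞) :
    volume.restrict (Set.Ioi 0) {t : ℝ | ENNReal.ofReal t < c} = c := by
  have h_meas : MeasurableSet {t : ℝ | ENNReal.ofReal t < c} :=
    measurableSet_lt ENNReal.measurable_ofReal measurable_const
  rw [Measure.restrict_apply h_meas]
  induction c with
  | top => simp
  | coe c =>
    have h_Ioo : {t : ℝ | ENNReal.ofReal t < c} ∩ Set.Ioi 0 = Set.Ioo 0 (c : ℝ) := by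
      ext t
      exact ⟨fun ⟨htc, ht⟩ => ⟨ht, (ENNReal.ofReal_lt_coe_iff ht.le).1 htc⟩,
        fun ⟨ht, htc⟩ => ⟨(ENNReal.ofReal_lt_coe_iff ht.le).2 htc, ht⟩⟩
    rw [h_Ioo, Real.volume_Ioo, sub_zero, ENNReal.ofReal_coe_nnreal]

theorem lintegral_tsum_setOf_ofReal_lt {X : Type u} (μ : PMF X) (f : X → ℝ≥0∞) :
    ∫⁻ t in Set.Ioi (0 : ℝ), ∑' x : {x | ENNReal.ofReal t < f x}, μ x = ∑' x, μ x * f x := by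
  have : Countable μ.support := μ.support_countable.to_subtype
  have h_supp {g : X → ℝ≥0∞} : ∑' x : μ.support, μ x * g x = ∑' x, μ x * g x :=
    tsum_subtype_eq_of_support_subset (f := fun x => μ x * g x)
      fun x hx => left_ne_zero_of_mul hx
  have h_meas (x : X) : MeasurableSet {t : ℝ | ENNReal.ofReal t < f x} :=
    measurableSet_lt ENNReal.measurable_ofReal measurable_const
  calc ∫⁻ t in Set.Ioi (0 : ℝ), ∑' x : {x | ENNReal.ofReal t < f x}, μ x
      = ∫⁻ t in Set.Ioi (0 : ℝ), ∑' x : μ.support,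
          μ x * {t : ℝ | ENNReal.ofReal t < f x}.indicator 1 t := by
        refine lintegral_congr fun t => ?_
        rw [h_supp (g := fun x => {t : ℝ | ENNReal.ofReal t < f x}.indicator 1 t), tsum_subtype]
        refine tsum_congr fun x => ?_
        by_cases hx : ENNReal.ofReal t < f x <;> simp [hx]
    _ = ∑' x : μ.support, μ x * f x := by
        rw [lintegral_tsum fun x : μ.support =>
          ((measurable_one.indicator (h_meas x)).const_mul _).aemeasurable]
        refine tsum_congr fun x => ?_
        rw [lintegral_const_mul _ (measurable_one.indicator (h_meas x)),
          lintegral_indicator_one (h_meas x), volume_setOf_ofReal_lt]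
    _ = ∑' x, μ x * f x := h_supp

variable {X : Type u} [MetricSpace X]

theorem setOf_lt_iSup_closedBall (f : X → ℝ≥0∞) (R : ℝ) (b : ℝ≥0∞) :
    {x | b < ⨆ y ∈ Metric.closedBall x R, f y}
      = ⋃ y ∈ {y | b < f y}, Metric.closedBall y R := by
  ext x
  simp only [Set.mem_ofPred_eq, lt_iSup_iff, Set.mem_iUnion, Metric.mem_closedBall,
    dist_comm x, exists_prop, and_comm]

/-- Both sides of the hypothesis are integrals over the level `t` of the masses in the
conclusion, with `b = t`. -/
theorem exists_tsum_iUnion_closedBall_lt (μ : PMF X) {R : ℝ} {f : X → ℝ≥0∞} {a : ℝ≥0∞}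
    (h : ∑' x, μ x * (⨆ y ∈ Metric.closedBall x R, f y) < a * ∑' x, μ x * f x) :
    ∃ b : ℝ≥0∞, ∑' x : ⋃ y ∈ {y | b < f y}, Metric.closedBall y R, μ x
      < a * ∑' x : {y | b < f y}, μ x := by
  by_contra! h_le
  refine h.not_ge ?_
  rw [← lintegral_tsum_setOf_ofReal_lt, ← lintegral_tsum_setOf_ofReal_lt]
  refine (lintegral_const_mul_le _ _).trans (lintegral_mono fun t => ?_)
  rw [setOf_lt_iSup_closedBall]
  exact h_le (ENNReal.ofReal t)

end LevelSets

section Variation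

variable {X : Type u} {V : Type*} [NormedAddCommGroup V]

/-- The `ℓ¹(μ)`-norm of `φ`. -/
noncomputable def weightedNorm (μ : PMF X) (φ : X → V) : ℝ≥0∞ :=
  ∑' x, μ x * ‖φ x‖ₑ

theorem weightedNorm_ne_top (μ : PMF X) {φ : X → V} {C : ℝ≥0∞} (hC : C ≠ ∞)
    (hφ : ∀ x, ‖φ x‖ₑ ≤ C) : weightedNorm μ φ ≠ ∞ :=
  ne_top_of_le_ne_top hC (tsum_mul_le_of_le μ hφ)

theorem weightedNorm_indicator_one (μ : PMF X) (A : Set X) :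
    weightedNorm μ (A.indicator (1 : X → ℂ)) = ∑' x : A, μ x := by
  rw [tsum_subtype]
  exact tsum_congr fun x => by by_cases hx : x ∈ A <;> simp [hx]

theorem tsum_weightedNorm (μ : PMF X) {ι : Type*} {φ : ι → X → V} {C : ℝ≥0∞}
    (h : ∀ x, ∑' i, ‖φ i x‖ₑ = C) : ∑' i, weightedNorm μ (φ i) = C := by
  simp only [weightedNorm]
  rw [ENNReal.tsum_comm]
  simp only [ENNReal.tsum_mul_left, h, ENNReal.tsum_mul_right, μ.tsum_coe, one_mul]

theorem toReal_tsum_mul (μ : PMF X) {g : X → ℝ≥0∞} (hg : ∀ x, g x ≠ ∞) :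
    (∑' x, μ x * g x).toReal = ∑' x : μ.support, (μ x).toReal * (g x).toReal := by
  have h_supp : Function.support (fun x => (μ x).toReal * (g x).toReal) ⊆ μ.support := fun x hx =>
    (ENNReal.toReal_ne_zero.1 (left_ne_zero_of_mul hx)).1
  rw [tsum_subtype_eq_of_support_subset h_supp,
    ENNReal.tsum_toReal_eq fun x => ENNReal.mul_ne_top (μ.apply_ne_top x) (hg x)]
  simp only [ENNReal.toReal_mul]

variable [MetricSpace X]

/-- The `R`-variation of `φ` at the point `x`, summed over the support of `μ` as in the functional
form of `ULA_μ`. -/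
noncomputable def localVariation (μ : PMF X) (R : ℝ) (φ : X → V) (x : X) : ℝ≥0∞ :=
  ∑' y : {y : X // y ∈ μ.support ∧ dist x y ≤ R}, ‖φ x - φ y‖ₑ

/-- The total `R`-variation of `φ` with respect to `μ`: the left side of the inequality in the
functional form of `ULA_μ`, in `[0, ∞]`. -/
noncomputable def variation (μ : PMF X) (R : ℝ) (φ : X → V) : ℝ≥0∞ :=
  ∑' x, μ x * localVariation μ R φ x

theorem tsum_inter_closedBall_le (μ : PMF X) {R : ℝ} {N : ℕ} {x : X}
    (hN : (Metric.closedBall x R).encard ≤ N) {g : X → ℝ≥0∞} {C : ℝ≥0∞}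
    (hg : ∀ y, dist x y ≤ R → g y ≤ C) :
    ∑' y : {y : X // y ∈ μ.support ∧ dist x y ≤ R}, g y ≤ N * C := by
  have h_subset : {y : X | y ∈ μ.support ∧ dist x y ≤ R} ⊆ Metric.closedBall x R :=
    fun y hy => Metric.mem_closedBall'.2 hy.2
  calc ∑' y : {y : X // y ∈ μ.support ∧ dist x y ≤ R}, g y
      ≤ ∑' _ : {y : X // y ∈ μ.support ∧ dist x y ≤ R}, C :=
        ENNReal.tsum_le_tsum fun y => hg y y.2.2
    _ = {y : X | y ∈ μ.support ∧ dist x y ≤ R}.encard * C := ENNReal.tsum_set_const _ _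
    _ ≤ N * C := by
        gcongr
        exact_mod_cast (Set.encard_le_encard h_subset).trans hN

theorem tsum_variation_le (μ : PMF X) {R : ℝ} {N : ℕ}
    (hN : ∀ x : X, (Metric.closedBall x R).encard ≤ N) {ι : Type*} {φ : ι → X → V} {δ : ℝ≥0∞}
    (h : ∀ x y, dist x y ≤ R → ∑' i, ‖φ i x - φ i y‖ₑ ≤ δ) :
    ∑' i, variation μ R (φ i) ≤ N * δ := by
  simp only [variation]
  rw [ENNReal.tsum_comm]
  simp only [ENNReal.tsum_mul_left]
  refine tsum_mul_le_of_le μ fun x => ?_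
  simp only [localVariation]
  rw [ENNReal.tsum_comm]
  exact tsum_inter_closedBall_le μ (hN x) (g := fun y => ∑' i, ‖φ i x - φ i y‖ₑ) (h x)

theorem localVariation_le (μ : PMF X) {R : ℝ} {N : ℕ} {x : X}
    (hN : (Metric.closedBall x R).encard ≤ N) {φ : X → V} {C : ℝ≥0∞}
    (h : ∀ y, dist x y ≤ R → ‖φ x - φ y‖ₑ ≤ C) : localVariation μ R φ x ≤ N * C :=
  tsum_inter_closedBall_le μ hN (g := fun y => ‖φ x - φ y‖ₑ) h

theorem variation_lt_iff (μ : PMF X) {R ε : ℝ} (hε : 0 ≤ ε) {N : ℕ}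
    (hN : ∀ x : X, (Metric.closedBall x R).encard ≤ N) {φ : X → V} {C : ℝ≥0∞} (hC : C ≠ ∞)
    (hφ : ∀ x, ‖φ x‖ₑ ≤ C) :
    variation μ R φ < ENNReal.ofReal ε * weightedNorm μ φ ↔
      ∑' x : μ.support, (μ x).toReal *
          ∑' y : {y : X // y ∈ μ.support ∧ dist (x : X) y ≤ R}, ‖φ x - φ y‖
        < ε * ∑' x : μ.support, (μ x).toReal * ‖φ x‖ := by
  have h_loc_le (x : X) : localVariation μ R φ x ≤ N * (C + C) :=
    localVariation_le μ (hN x) fun y _ => enorm_sub_le.trans (add_le_add (hφ x) (hφ y))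
  have h_top : N * (C + C) ≠ ∞ := by finiteness
  have h_loc (x : X) : (localVariation μ R φ x).toReal
      = ∑' y : {y : X // y ∈ μ.support ∧ dist x y ≤ R}, ‖φ x - φ y‖ := by
    simp only [localVariation, ENNReal.tsum_toReal_eq fun _ => enorm_ne_top, toReal_enorm]
  have h_var := toReal_tsum_mul μ fun x => ne_top_of_le_ne_top h_top (h_loc_le x)
  have h_norm := toReal_tsum_mul μ (g := fun x => ‖φ x‖ₑ) fun _ => enorm_ne_top
  simp only [h_loc, toReal_enorm] at h_var h_norm
  rw [← h_var, ← h_norm, ← ENNReal.toReal_ofReal_mul ε _ hε]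
  exact (ENNReal.toReal_lt_toReal (ne_top_of_le_ne_top h_top (tsum_mul_le_of_le μ h_loc_le))
    (ENNReal.mul_ne_top ENNReal.ofReal_ne_top (weightedNorm_ne_top μ hC hφ))).symm

theorem iSup_closedBall_indicator_enorm_le (μ : PMF X) (R : ℝ) (φ : X → V) (x : X) :
    ⨆ y ∈ Metric.closedBall x R, μ.support.indicator (fun y => ‖φ y‖ₑ) y
      ≤ ‖φ x‖ₑ + localVariation μ R φ x := by
  refine iSup₂_le fun y hy => Set.indicator_apply_le' (fun hyμ => ?_) fun _ => zero_le
  calc ‖φ y‖ₑ = ‖φ x - (φ x - φ y)‖ₑ := by rw [sub_sub_cancel]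
    _ ≤ ‖φ x‖ₑ + ‖φ x - φ y‖ₑ := enorm_sub_le
    _ ≤ ‖φ x‖ₑ + localVariation μ R φ x := by
        gcongr
        exact ENNReal.le_tsum (f := fun y : {y : X // y ∈ μ.support ∧ dist x y ≤ R} =>
          ‖φ x - φ y‖ₑ) ⟨y, hyμ, Metric.mem_closedBall'.1 hy⟩

theorem exists_subset_support_of_variation_lt (μ : PMF X) {R ε : ℝ} {φ : X → V}
    (hφ : weightedNorm μ φ ≠ ∞)
    (h : variation μ R φ < ENNReal.ofReal ε * weightedNorm μ φ) :
    ∃ E ⊆ Function.support φ, ∑' x : ⋃ x ∈ E, Metric.closedBall x R, μ x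
      < (1 + ENNReal.ofReal ε) * ∑' x : E, μ x := by
  set f : X → ℝ≥0∞ := μ.support.indicator fun x => ‖φ x‖ₑ with hf
  have h_norm : ∑' x, μ x * f x = weightedNorm μ φ := tsum_congr fun x => by
    by_cases hx : x ∈ μ.support
    · rw [hf, Set.indicator_of_mem hx]
    · rw [(μ.apply_eq_zero_iff x).2 hx, zero_mul, zero_mul]
  obtain ⟨b, hb⟩ := exists_tsum_iUnion_closedBall_lt μ (R := R) (f := f)
    (a := 1 + ENNReal.ofReal ε) <|
    calc ∑' x, μ x * (⨆ y ∈ Metric.closedBall x R, f y)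
        ≤ ∑' x, μ x * (‖φ x‖ₑ + localVariation μ R φ x) := ENNReal.tsum_le_tsum fun x => by
          gcongr
          exact iSup_closedBall_indicator_enorm_le μ R φ x
      _ = weightedNorm μ φ + variation μ R φ := by
          simp only [mul_add, ENNReal.tsum_add, weightedNorm, variation]
      _ < weightedNorm μ φ + ENNReal.ofReal ε * weightedNorm μ φ := by gcongr
      _ = (1 + ENNReal.ofReal ε) * ∑' x, μ x * f x := by rw [h_norm, one_add_mul]
  refine ⟨{y | b < f y}, fun y (hy : b < f y) (hy₀ : φ y = 0) => ?_, hb⟩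
  have hfy : f y = 0 := Set.indicator_apply_eq_zero.2 fun _ => by rw [hy₀, enorm_zero]
  exact not_lt_zero (hfy ▸ hy)

end Variation

section FunctionalLocalAmenability

variable {X : Type u}

theorem tsum_enorm_toReal_sub (p q : PMF X) :
    ∑' z, ‖(p z).toReal - (q z).toReal‖ₑ
      = ENNReal.ofReal (∑' z, |(p z).toReal - (q z).toReal|) := by
  have h_summable (p : PMF X) : Summable fun z => (p z).toReal :=
    ENNReal.summable_toReal p.tsum_coe_ne_top
  rw [ENNReal.ofReal_tsum_of_nonneg (fun _ => abs_nonneg _)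
    ((h_summable p).sub (h_summable q)).abs]
  simp only [Real.enorm_eq_ofReal_abs]

theorem natCast_mul_ofReal_div_lt (N : ℕ) {ε : ℝ} (hε : 0 < ε) :
    N * ENNReal.ofReal (ε / (N + 1)) < ENNReal.ofReal ε := by
  rw [← ENNReal.ofReal_natCast, ← ENNReal.ofReal_mul N.cast_nonneg,
    ENNReal.ofReal_lt_ofReal_iff hε, mul_div_assoc', div_lt_iff₀ (by positivity)]
  linarith

variable [MetricSpace X]

theorem ULAmuFun.ulamu (h : ULAmuFun X) (hX : BoundedGeometry X) : ULAmu X := by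
  refine ulamu_of_forall_exists fun R hR ε hε => ?_
  obtain ⟨S, hS, h⟩ := h R hR ε hε
  obtain ⟨N, hN⟩ := hX R hR
  refine ⟨S, hS, fun μ => ?_⟩
  obtain ⟨φ, hdiam, hlt⟩ := h μ
  have hφ (x : X) : ‖φ x‖ₑ ≤ ‖φ‖ₑ :=
    enorm_le_iff_norm_le.2 (lp.norm_apply_le_norm one_ne_zero φ x)
  obtain ⟨E, hE, hE_lt⟩ := exists_subset_support_of_variation_lt μ
    (weightedNorm_ne_top μ enorm_ne_top hφ)
    ((variation_lt_iff μ hε.le hN enorm_ne_top hφ).2 hlt)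
  exact ⟨E, hdiam.mono hE le_rfl, hE_lt⟩

/-- Averaged over `z`, the functions `x ↦ ξ x z` have variation at most `ε` times their norm. -/
theorem PropertyA.ulamu (h : PropertyA X) (hX : BoundedGeometry X) : ULAmu X := by
  refine ulamu_of_forall_exists fun R hR ε hε => ?_
  obtain ⟨N, hN⟩ := hX R hR
  obtain ⟨S, hS, ξ, hξ, hξS⟩ := h R hR (ε / (N + 1)) (by positivity)
  refine ⟨2 * S, by positivity, fun μ => ?_⟩
  set φ : X → X → ℝ := fun z x => (ξ x z).toReal
  have hφ (z x : X) : ‖φ z x‖ₑ = ξ x z := by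
    rw [Real.enorm_of_nonneg ENNReal.toReal_nonneg, ENNReal.ofReal_toReal ((ξ x).apply_ne_top z)]
  have h_var : ∑' z, variation μ R (φ z) ≤ N * ENNReal.ofReal (ε / (N + 1)) :=
    tsum_variation_le μ hN fun x y hxy => by
      rw [tsum_enorm_toReal_sub]
      exact ENNReal.ofReal_le_ofReal (hξ x y hxy).le
  have h_norm : ∑' z, weightedNorm μ (φ z) = 1 :=
    tsum_weightedNorm μ fun x => by simp only [hφ, (ξ x).tsum_coe]
  obtain ⟨z, hz⟩ : ∃ z, variation μ R (φ z) < ENNReal.ofReal ε * weightedNorm μ (φ z) := by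
    by_contra! h_le
    refine (h_var.trans_lt (natCast_mul_ofReal_div_lt N hε)).not_ge ?_
    simpa only [ENNReal.tsum_mul_left, h_norm, mul_one] using ENNReal.tsum_le_tsum h_le
  obtain ⟨E, hE, hE_lt⟩ := exists_subset_support_of_variation_lt μ
    (weightedNorm_ne_top μ ENNReal.one_ne_top fun x => (hφ z x).trans_le ((ξ x).coe_le_one z)) hz
  refine ⟨E, (diamLE_closedBall z hS.le).mono (fun x hx => ?_) le_rfl, hE_lt⟩
  have hzx : z ∈ (ξ x).support := (ENNReal.toReal_ne_zero.1 (hE hx)).1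
  exact Metric.mem_closedBall'.2 (Metric.mem_closedBall.1 (hξS x hzx))

theorem enorm_indicator_cthickening_sub_le {R : ℝ} (hR : 0 ≤ R) (E : Set X) {x y : X}
    (hxy : dist x y ≤ R) :
    ‖(Metric.cthickening R E).indicator (1 : X → ℂ) x
        - (Metric.cthickening R E).indicator (1 : X → ℂ) y‖ₑ
      ≤ (boundary (2 * R) E).indicator 1 x := by
  classical
  by_cases hx : x ∈ boundary (2 * R) E
  · simp only [Set.indicator_apply, hx]
    split_ifs <;> simp
  have h_iff : x ∈ Metric.cthickening R E ↔ y ∈ Metric.cthickening R E := by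
    by_cases hxE : x ∈ E
    · exact iff_of_true (Metric.self_subset_cthickening E hxE)
        (Metric.mem_cthickening_of_dist_le y x R E hxE (dist_comm x y ▸ hxy))
    have hx₂ : x ∉ Metric.cthickening (2 * R) E := fun hx₂ => hx ⟨hx₂, hxE⟩
    refine iff_of_false (fun hx₁ => hx₂ ?_) fun hy => hx₂ ?_
    · exact Metric.cthickening_mono (by linarith) E hx₁
    · rw [two_mul]
      exact Metric.cthickening_cthickening_subset hR hR E
        (Metric.mem_cthickening_of_dist_le x y R _ hy hxy)
  simp only [Set.indicator_apply, h_iff, Pi.one_apply, sub_self, enorm_zero, zero_le]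

theorem variation_indicator_cthickening_le (μ : PMF X) {R : ℝ} (hR : 0 ≤ R) {N : ℕ}
    (hN : ∀ x : X, (Metric.closedBall x R).encard ≤ N) (E : Set X) :
    variation μ R ((Metric.cthickening R E).indicator (1 : X → ℂ))
      ≤ N * ∑' x : boundary (2 * R) E, μ x := by
  rw [tsum_subtype, ← ENNReal.tsum_mul_left]
  refine ENNReal.tsum_le_tsum fun x => ?_
  have h_loc := localVariation_le μ (hN x)
    fun y => enorm_indicator_cthickening_sub_le hR E (x := x) (y := y)
  refine (mul_le_mul_right h_loc (μ x)).trans_eq ?_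
  rw [mul_left_comm]
  by_cases hx : x ∈ boundary (2 * R) E <;> simp [hx]

/-- `E` is taken almost invariant at scale `2 * R`: the variation of the indicator function of the
`R`-thickening of `E` then lives on the `2 * R`-boundary of `E`, whereas that of the indicator
function of `E` itself also involves points of `E`. -/
theorem ULAmu.ulamuFun (h : ULAmu X) (hX : BoundedGeometry X) : ULAmuFun X := by
  intro R hR ε hε
  obtain ⟨N, hN⟩ := hX R hR
  obtain ⟨S, hS, h⟩ := h (2 * R) (by positivity) (ε / (N + 1)) (by positivity)
  refine ⟨S + 2 * R, by positivity, fun μ => ?_⟩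
  obtain ⟨E, -, hE, hlt⟩ := h μ
  rw [mass_lt_mul_mass_iff μ (by positivity)] at hlt
  have hE_ne : ∑' x : E, μ x ≠ 0 := right_ne_zero_of_mul (ne_zero_of_lt hlt)
  set A := Metric.cthickening R E
  have hA : DiamLE A (S + 2 * R) := hE.cthickening hS.le hR.le
  have hA_supp : Function.support (A.indicator (1 : X → ℂ)) ⊆ A := Set.support_indicator_subset
  have h_mem : Memℓp (A.indicator (1 : X → ℂ)) 1 :=
    (memℓp_zero ((hA.finite (by positivity) hX).subset hA_supp)).of_exponent_ge zero_le
  have h_le_one (x : X) : ‖A.indicator (1 : X → ℂ) x‖ₑ ≤ 1 := by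
    by_cases hx : x ∈ A <;> simp [hx]
  refine ⟨⟨A.indicator 1, h_mem⟩, hA.mono hA_supp le_rfl,
    (variation_lt_iff μ hε.le hN ENNReal.one_ne_top h_le_one).1 ?_⟩
  calc variation μ R (A.indicator (1 : X → ℂ))
      ≤ N * ∑' x : boundary (2 * R) E, μ x := variation_indicator_cthickening_le μ hR.le hN E
    _ ≤ N * (ENNReal.ofReal (ε / (N + 1)) * ∑' x : E, μ x) := by gcongr
    _ = N * ENNReal.ofReal (ε / (N + 1)) * ∑' x : E, μ x := (mul_assoc _ _ _).symm
    _ < ENNReal.ofReal ε * ∑' x : E, μ x :=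
        ENNReal.mul_lt_mul_left hE_ne (tsum_subtype_pmf_ne_top μ E)
          (natCast_mul_ofReal_div_lt N hε)
    _ ≤ ENNReal.ofReal ε * weightedNorm μ (A.indicator (1 : X → ℂ)) := by
        rw [weightedNorm_indicator_one]
        gcongr
        exact ENNReal.tsum_mono_subtype μ (Metric.self_subset_cthickening E)

end FunctionalLocalAmenability

section WeightedL2

variable {X : Type u} {μ : PMF X} {H : Type v} [NormedAddCommGroup H]

theorem discreteMeasure_apply (μ : PMF X) (A : Set X) :
    discreteMeasure μ A = μ.toOuterMeasure A :=
  letI : MeasurableSpace X := ⊤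
  μ.toMeasure_apply_eq_toOuterMeasure_apply trivial

theorem ae_discreteMeasure_iff {p : X → Prop} :
    (∀ᵐ x ∂(discreteMeasure μ), p x) ↔ ∀ x ∈ μ.support, p x := by
  rw [ae_iff, discreteMeasure_apply, PMF.toOuterMeasure_apply_eq_zero_iff, Set.disjoint_left]
  simp only [Set.mem_ofPred_eq, not_not]

theorem lintegral_discreteMeasure (μ : PMF X) (f : X → ℝ≥0∞) :
    ∫⁻ x, f x ∂(discreteMeasure μ) = ∑' x, μ x * f x := by
  let m : MeasurableSpace X := ⊤
  have : DiscreteMeasurableSpace X := ⟨fun _ => trivial⟩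
  have h_restrict : (discreteMeasure μ).restrict μ.support = discreteMeasure μ :=
    μ.restrict_toMeasure_support
  have h_singleton (x : X) : discreteMeasure μ {x} = μ x := by
    rw [discreteMeasure_apply, PMF.toOuterMeasure_apply_singleton]
  rw [← h_restrict, lintegral_countable f μ.support_countable]
  simp only [h_singleton, mul_comm (f _)]
  exact tsum_subtype_eq_of_support_subset (f := fun x => μ x * f x)
    fun x hx => left_ne_zero_of_mul hx

theorem weightedL2_ext {φ ψ : WeightedL2 μ H}
    (h : ∀ x ∈ μ.support, (φ : X → H) x = (ψ : X → H) x) : φ = ψ :=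
  Lp.ext (ae_discreteMeasure_iff.2 h)

theorem pointFunction_apply (y : X) (h : H) {x : X} (hx : x ∈ μ.support) :
    (pointFunction μ y h : X → H) x = ({y} : Set X).indicator (fun _ => h) x :=
  ae_discreteMeasure_iff.1 indicatorConstLp_coeFn x hx

theorem enorm_sq_eq_tsum (φ : WeightedL2 μ H) :
    ‖φ‖ₑ ^ 2 = ∑' x, μ x * ‖(φ : X → H) x‖ₑ ^ 2 := by
  rw [Lp.enorm_def, ← lintegral_discreteMeasure]
  simpa using eLpNorm_nnreal_pow_eq_lintegral (μ := discreteMeasure μ) (f := (φ : X → H))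
    (p := 2) two_ne_zero

/-- The restriction of an element of `ℓ²(X, μ, H)` to a set `A`, that is, its product with the
indicator function of `A`. -/
noncomputable def restrictTo (φ : WeightedL2 μ H) (A : Set X) : WeightedL2 μ H :=
  ((Lp.memLp φ).indicator (s := A) MeasurableSpace.measurableSet_top).toLp

theorem restrictTo_apply (φ : WeightedL2 μ H) (A : Set X) {x : X} (hx : x ∈ μ.support) :
    (restrictTo φ A : X → H) x = A.indicator (φ : X → H) x :=
  ae_discreteMeasure_iff.1 (MemLp.coeFn_toLp _) x hx

theorem enorm_restrictTo_sq (φ : WeightedL2 μ H) (A : Set X) :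
    ‖restrictTo φ A‖ₑ ^ 2 = ∑' x : A, μ x * ‖(φ : X → H) x‖ₑ ^ 2 := by
  rw [enorm_sq_eq_tsum, tsum_subtype A fun x => μ x * ‖(φ : X → H) x‖ₑ ^ 2]
  refine tsum_congr fun x => ?_
  by_cases hx : x ∈ μ.support
  · rw [restrictTo_apply φ A hx]
    by_cases hA : x ∈ A <;> simp [hA]
  · by_cases hA : x ∈ A <;> simp [hA, (μ.apply_eq_zero_iff x).2 hx]

theorem l2Support_restrictTo_subset (φ : WeightedL2 μ H) (A : Set X) :
    l2Support (restrictTo φ A) ⊆ A := by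
  rintro x ⟨hx, hne⟩
  rw [restrictTo_apply φ A hx] at hne
  exact Set.mem_of_indicator_ne_zero hne

theorem toReal_mul_norm_apply_sq_le (φ : WeightedL2 μ H) (x : X) :
    (μ x).toReal * ‖(φ : X → H) x‖ ^ 2 ≤ ‖φ‖ ^ 2 := by
  have h_le : μ x * ‖(φ : X → H) x‖ₑ ^ 2 ≤ ‖φ‖ₑ ^ 2 :=
    enorm_sq_eq_tsum φ ▸ ENNReal.le_tsum (f := fun x => μ x * ‖(φ : X → H) x‖ₑ ^ 2) x
  simpa using ENNReal.toReal_mono (by finiteness) h_le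

variable [NormedSpace ℂ H]

/-- Evaluation at a point of positive mass, as a bounded operator `ℓ²(X, μ, H) → H`. -/
noncomputable def evaluation {x : X} (hx : x ∈ μ.support) : WeightedL2 μ H →L[ℂ] H :=
  LinearMap.mkContinuous
    { toFun := fun φ => (φ : X → H) x
      map_add' := fun φ ψ => ae_discreteMeasure_iff.1 (Lp.coeFn_add φ ψ) x hx
      map_smul' := fun a φ => ae_discreteMeasure_iff.1 (Lp.coeFn_smul a φ) x hx }
    (√(μ x).toReal)⁻¹ fun φ => by
      have h_pos : 0 < (μ x).toReal := ENNReal.toReal_pos hx (μ.apply_ne_top x)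
      refine (sq_le_sq₀ (norm_nonneg _) (by positivity)).1 ?_
      rw [mul_pow, inv_pow, Real.sq_sqrt h_pos.le, le_inv_mul_iff₀ h_pos]
      exact toReal_mul_norm_apply_sq_le φ x

theorem evaluation_apply {x : X} (hx : x ∈ μ.support) (φ : WeightedL2 μ H) :
    evaluation hx φ = (φ : X → H) x :=
  rfl

theorem pointFunction_eq_zero {y : X} {h : H} (hyh : y ∈ μ.support → h = 0) :
    pointFunction μ y h = 0 :=
  weightedL2_ext fun x hx => by
    rw [pointFunction_apply y h hx, ← evaluation_apply hx 0, map_zero]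
    exact Set.indicator_apply_eq_zero.2 fun hxy => hyh (Set.mem_singleton_iff.1 hxy ▸ hx)

theorem restrictTo_compl_finset (φ : WeightedL2 μ H) (F : Finset X) :
    restrictTo φ (F : Set X)ᶜ = φ - ∑ y ∈ F, pointFunction μ y ((φ : X → H) y) := by
  classical
  refine weightedL2_ext fun x hx => ?_
  rw [restrictTo_apply φ _ hx, ← evaluation_apply hx (φ - _), map_sub, map_sum]
  simp only [evaluation_apply, pointFunction_apply _ _ hx, Set.indicator_apply,
    Set.mem_singleton_iff, Finset.sum_ite_eq, Set.mem_compl_iff, Finset.mem_coe]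
  split_ifs <;> simp_all

theorem hasSum_pointFunction (φ : WeightedL2 μ H) :
    HasSum (fun y => pointFunction μ y ((φ : X → H) y)) φ := by
  have h_top : ∑' x, μ x * ‖(φ : X → H) x‖ₑ ^ 2 ≠ ∞ := by
    rw [← enorm_sq_eq_tsum]
    finiteness
  have h_sq : Filter.Tendsto (fun F : Finset X => ‖restrictTo φ (F : Set X)ᶜ‖ₑ ^ 2)
      Filter.atTop (nhds 0) := by
    simp only [enorm_restrictTo_sq]
    exact ENNReal.tendsto_tsum_compl_atTop_zero h_top
  refine tendsto_iff_edist_tendsto_0.2 ?_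
  simp only [edist_comm _ φ, edist_eq_enorm_sub, ← restrictTo_compl_finset]
  have h_sqrt := h_sq.ennrpow_const (1 / 2)
  simp only [← ENNReal.rpow_natCast, ← ENNReal.rpow_mul] at h_sqrt
  simpa using h_sqrt

theorem l2Support_smul_subset (a : ℂ) (φ : WeightedL2 μ H) : l2Support (a • φ) ⊆ l2Support φ :=
  fun x ⟨hx, hne⟩ => ⟨hx, right_ne_zero_of_smul (a := a)
    (by rwa [← evaluation_apply hx, map_smul] at hne)⟩

theorem exists_norm_eq_one_and_l2Support_subset {W : Type*} [NormedAddCommGroup W] [NormedSpace ℂ W]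
    (T : WeightedL2 μ H →L[ℂ] W) {φ : WeightedL2 μ H} (hφ : φ ≠ 0) {a : ℝ}
    (h : a * ‖φ‖ ≤ ‖T φ‖) :
    ∃ ψ : WeightedL2 μ H, ‖ψ‖ = 1 ∧ l2Support ψ ⊆ l2Support φ ∧ a ≤ ‖T ψ‖ := by
  refine ⟨(‖φ‖⁻¹ : ℂ) • φ, norm_smul_inv_norm hφ, l2Support_smul_subset _ φ, ?_⟩
  rwa [map_smul, norm_smul, norm_inv, Complex.norm_real, norm_norm,
    le_inv_mul_iff₀ (norm_pos_iff.2 hφ), mul_comm]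

theorem exists_norm_eq_one_and_subsingleton_l2Support [Nontrivial H] (μ : PMF X) :
    ∃ φ : WeightedL2 μ H, ‖φ‖ = 1 ∧ (l2Support φ).Subsingleton := by
  obtain ⟨y, hy⟩ := μ.support_nonempty
  obtain ⟨k, hk⟩ := exists_ne (0 : H)
  have h_ne : pointFunction μ y k ≠ 0 := fun h_zero => hk <| by
    have h_eval := pointFunction_apply y k hy
    rwa [h_zero, ← evaluation_apply hy, map_zero, Set.indicator_of_mem (Set.mem_singleton y),
      eq_comm] at h_eval
  have h_supp : l2Support (pointFunction μ y k) ⊆ {y} := fun x ⟨hx, hne⟩ => by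
    rw [pointFunction_apply y k hx] at hne
    exact Set.mem_of_indicator_ne_zero hne
  obtain ⟨φ, hφ, hφ_supp, -⟩ := exists_norm_eq_one_and_l2Support_subset (0 : _ →L[ℂ] ℂ) h_ne
    (a := 0) (by simp)
  exact ⟨φ, hφ, Set.subsingleton_singleton.anti (hφ_supp.trans h_supp)⟩

end WeightedL2

section OperatorNormLocalisation

variable {X : Type u} [MetricSpace X]

/-- Operator norm localisation, as in `ONL`, for operators on `ℓ²(X, μ, H)` with `H` an arbitrary
nonzero complex inner product space. -/
def ONLPreHilbert (X : Type u) [MetricSpace X] : Prop :=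
  ∃ c : ℝ, 0 < c ∧ ∀ R : ℝ, 0 < R → ∃ S : ℝ, 0 < S ∧
    ∀ (μ : PMF X) (H : Type v) [NormedAddCommGroup H] [InnerProductSpace ℂ H] [Nontrivial H]
      (T : WeightedL2 μ H →L[ℂ] WeightedL2 μ H), PropagationLE T R →
      ∃ φ : WeightedL2 μ H, ‖φ‖ = 1 ∧ DiamLE (l2Support φ) S ∧ c * ‖T‖ ≤ ‖T φ‖

theorem ONLPreHilbert.onl (h : ONLPreHilbert.{u, v} X) : ONL.{u, v} X := by
  obtain ⟨c, hc, h⟩ := h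
  refine ⟨c, hc, fun R hR => ?_⟩
  obtain ⟨S, hS, h⟩ := h R hR
  exact ⟨S, hS, fun μ H _ _ _ _ _ => h μ H⟩

variable {μ : PMF X} {H : Type v} [NormedAddCommGroup H] [InnerProductSpace ℂ H]
  {T : WeightedL2 μ H →L[ℂ] WeightedL2 μ H}

theorem PropagationLE.apply_eq_zero {R : ℝ} (hT : PropagationLE T R) {x : X}
    (hx : x ∈ μ.support) {φ : WeightedL2 μ H}
    (hφ : ∀ y ∈ μ.support, dist x y ≤ R → (φ : X → H) y = 0) : (T φ : X → H) x = 0 := by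
  have h_sum := (hasSum_pointFunction φ).mapL ((evaluation hx).comp T)
  have h_zero (y : X) : evaluation hx (T (pointFunction μ y ((φ : X → H) y))) = 0 := by
    by_cases hy : y ∈ μ.support ∧ R < dist x y
    · exact hT x hx y hy.1 hy.2 _
    · rw [pointFunction_eq_zero fun hyμ => hφ y hyμ (not_lt.1 fun hlt => hy ⟨hyμ, hlt⟩), map_zero,
        map_zero]
  exact h_sum.unique (by simpa only [ContinuousLinearMap.comp_apply, h_zero] using hasSum_zero)

theorem PropagationLE.apply_restrictTo {R : ℝ} (hT : PropagationLE T R) (φ : WeightedL2 μ H)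
    {A : Set X} {x : X} (hx : x ∈ μ.support) (hxA : x ∈ A) :
    (T (restrictTo φ (Metric.cthickening R A)) : X → H) x = (T φ : X → H) x := by
  have h_zero : (T (φ - restrictTo φ (Metric.cthickening R A)) : X → H) x = 0 := by
    refine hT.apply_eq_zero hx fun y hy hxy => ?_
    have hyA : y ∈ Metric.cthickening R A :=
      Metric.mem_cthickening_of_dist_le y x R A hxA (dist_comm x y ▸ hxy)
    rw [← evaluation_apply hy, map_sub, evaluation_apply, evaluation_apply,
      restrictTo_apply φ _ hy, Set.indicator_of_mem hyA, sub_self]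
  rw [← evaluation_apply hx, map_sub, map_sub, sub_eq_zero] at h_zero
  exact h_zero.symm

theorem PropagationLE.exists_mul_enorm_restrictTo_lt {R R' S : ℝ} (hT : PropagationLE T R)
    (hR : 0 ≤ R) (hRR' : 2 * R < R') {P : Set (Set X)} (hP : IsSparse P R' S)
    {φ : WeightedL2 μ H} {a : ℝ≥0∞}
    (h : (a * ‖φ‖ₑ) ^ 2 < ∑' x : ⋃₀ P, μ x * ‖(T φ : X → H) x‖ₑ ^ 2) :
    ∃ A ∈ P, a * ‖restrictTo φ (Metric.cthickening R A)‖ₑ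
      < ‖T (restrictTo φ (Metric.cthickening R A))‖ₑ := by
  rw [mul_pow, enorm_sq_eq_tsum, ← ENNReal.tsum_mul_left] at h
  obtain ⟨A, hA, hlt⟩ := hP.exists_tsum_cthickening_lt hR hRR'
    (f := fun x => μ x * ‖(T φ : X → H) x‖ₑ ^ 2) h
  refine ⟨A, hA, lt_of_pow_lt_pow_left' 2 ?_⟩
  set ψ := restrictTo φ (Metric.cthickening R A)
  calc (a * ‖ψ‖ₑ) ^ 2
      = ∑' x : Metric.cthickening R A, a ^ 2 * (μ x * ‖(φ : X → H) x‖ₑ ^ 2) := by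
        rw [mul_pow, enorm_restrictTo_sq, ENNReal.tsum_mul_left]
    _ < ∑' x : A, μ x * ‖(T φ : X → H) x‖ₑ ^ 2 := hlt
    _ = ∑' x : A, μ x * ‖(T ψ : X → H) x‖ₑ ^ 2 := tsum_congr fun x => by
        by_cases hx : (x : X) ∈ μ.support
        · rw [hT.apply_restrictTo φ hx x.2]
        · rw [(μ.apply_eq_zero_iff x).2 hx, zero_mul, zero_mul]
    _ ≤ ‖T ψ‖ₑ ^ 2 := by
        rw [enorm_sq_eq_tsum]
        exact ENNReal.tsum_comp_le_tsum_of_injective Subtype.val_injective _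

theorem PropagationLE.exists_mul_norm_lt {R R' S c : ℝ} (hT : PropagationLE T R) (hT₀ : T ≠ 0)
    (hR : 0 ≤ R) (hRR' : 2 * R < R') (hS : 0 ≤ S) (hc : 0 < c)
    (h : ∀ w : X → ℝ≥0∞, ∑' x, w x ≠ 0 → ∑' x, w x ≠ ∞ → ∃ P : Set (Set X), IsSparse P R' S ∧
      ENNReal.ofReal c * ∑' x, w x ≤ ∑' x : ⋃₀ P, w x) :
    ∃ φ : WeightedL2 μ H, DiamLE (l2Support φ) (S + 2 * R) ∧
      √c / 2 * ‖T‖ * ‖φ‖ < ‖T φ‖ := by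
  have hT_pos : 0 < ‖T‖ := (norm_pos_iff (a := T)).2 hT₀
  obtain ⟨φ, hφ, hTφ⟩ := T.exists_lt_apply_of_lt_opNorm (half_lt_self hT_pos)
  have h_sum := enorm_sq_eq_tsum (T φ)
  have hTφ_ne : ‖T φ‖ₑ ^ 2 ≠ 0 := by
    have : T φ ≠ 0 := norm_pos_iff.1 ((half_pos hT_pos).trans hTφ)
    simpa using this
  obtain ⟨P, hP, hle⟩ := h (fun x => μ x * ‖(T φ : X → H) x‖ₑ ^ 2) (h_sum ▸ hTφ_ne)
    (h_sum ▸ by finiteness)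
  have h_real : (√c / 2 * ‖T‖ * ‖φ‖) ^ 2 < c * ‖T φ‖ ^ 2 :=
    calc (√c / 2 * ‖T‖ * ‖φ‖) ^ 2 = c * (‖T‖ / 2 * ‖φ‖) ^ 2 := by
          rw [show √c / 2 * ‖T‖ * ‖φ‖ = √c * (‖T‖ / 2 * ‖φ‖) by ring, mul_pow, Real.sq_sqrt hc.le]
      _ ≤ c * (‖T‖ / 2) ^ 2 := by gcongr; exact mul_le_of_le_one_right (by positivity) hφ.le
      _ < c * ‖T φ‖ ^ 2 := by gcongr
  have h_enorm : (ENNReal.ofReal (√c / 2 * ‖T‖) * ‖φ‖ₑ) ^ 2 < ENNReal.ofReal c * ‖T φ‖ₑ ^ 2 := by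
    rw [← ofReal_norm, ← ofReal_norm, ← ENNReal.ofReal_mul (by positivity),
      ← ENNReal.ofReal_pow (by positivity), ← ENNReal.ofReal_pow (by positivity),
      ← ENNReal.ofReal_mul hc.le]
    exact (ENNReal.ofReal_lt_ofReal_iff_of_nonneg (by positivity)).2 h_real
  obtain ⟨A, hA, hlt⟩ := hT.exists_mul_enorm_restrictTo_lt hR hRR' hP
    (h_enorm.trans_le (h_sum ▸ hle))
  refine ⟨_, ((hP.diamLE A hA).cthickening hS hR).mono (l2Support_restrictTo_subset φ _) le_rfl, ?_⟩
  rwa [← ofReal_norm, ← ofReal_norm, ← ENNReal.ofReal_mul (by positivity),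
    ENNReal.ofReal_lt_ofReal_iff_of_nonneg (by positivity)] at hlt

/-- Since `T` has propagation at most `R`, on a piece `A` the function `T φ` depends only on the
restriction of `φ` to the `R`-thickening of `A`, and these thickenings are disjoint. -/
theorem MSP.onlPreHilbert (h : MSP X) : ONLPreHilbert.{u, v} X := by
  obtain ⟨c, hc, h⟩ := h.exists_isSparse
  refine ⟨√c / 2, by positivity, fun R hR => ?_⟩
  obtain ⟨S, hS, h⟩ := h (3 * R) (by positivity)
  refine ⟨S + 2 * R, by positivity, fun μ H _ _ _ T hT => ?_⟩
  rcases eq_or_ne T 0 with rfl | hT₀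
  · obtain ⟨φ, hφ, hφ_supp⟩ := exists_norm_eq_one_and_subsingleton_l2Support (H := H) μ
    exact ⟨φ, hφ, (Metric.ediam_subsingleton hφ_supp).trans_le zero_le,
      by rw [ContinuousLinearMap.opNorm_zero, mul_zero]; exact norm_nonneg _⟩
  · obtain ⟨φ, hφ_supp, hlt⟩ :=
      hT.exists_mul_norm_lt hT₀ hR.le (by linarith) hS.le hc h
    have hφ : φ ≠ 0 := by
      rintro rfl
      simp at hlt
    obtain ⟨ψ, hψ, hψ_supp, hle⟩ := exists_norm_eq_one_and_l2Support_subset T hφ hlt.le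
    exact ⟨ψ, hψ, hφ_supp.mono hψ_supp le_rfl, hle⟩

end OperatorNormLocalisation

section AmenableGroups

theorem tsum_abs_uniformOfFinset_sub {α : Type*} {A B : Finset α} (hA : A.Nonempty)
    (hB : B.Nonempty) (h_card : A.card = B.card) :
    ∑' z, |(PMF.uniformOfFinset A hA z).toReal - (PMF.uniformOfFinset B hB z).toReal|
      = ((A : Set α) ∆ (B : Set α)).ncard / (A.card : ℝ) := by
  classical
  rw [← Finset.coe_symmDiff, Set.ncard_coe_finset, tsum_eq_sum (s := A ∆ B), div_eq_mul_inv,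
    ← nsmul_eq_mul, ← Finset.sum_const]
  · refine Finset.sum_congr rfl fun z hz => ?_
    rcases Finset.mem_symmDiff.1 hz with ⟨hzA, hzB⟩ | ⟨hzB, hzA⟩
    · simp [PMF.uniformOfFinset_apply, hzA, hzB]
    · simp [PMF.uniformOfFinset_apply, hzA, hzB, h_card]
  · intro z hz
    have h_iff : z ∈ A ↔ z ∈ B := by
      simp only [Finset.mem_symmDiff] at hz
      tauto
    simp only [PMF.uniformOfFinset_apply, h_iff, h_card, sub_self, abs_zero]

variable {G : Type w} [Group G]

theorem smul_symmDiff_smul (x y : G) (F : Set G) :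
    (x • F) ∆ (y • F) = x • (((x⁻¹ * y) • F) ∆ F) := by
  rw [Set.smul_set_symmDiff, smul_smul, mul_inv_cancel_left, symmDiff_comm]

variable [MetricSpace G] [IsIsometricSMul G G]

theorem ProperGroupMetric.boundedGeometry (hG : ProperGroupMetric G) : BoundedGeometry G := by
  refine fun R _ => ⟨(Metric.closedBall (1 : G) R).ncard, fun g => ?_⟩
  have h_ball : Metric.closedBall g R = g • Metric.closedBall (1 : G) R := by
    rw [Metric.smul_closedBall, smul_eq_mul, mul_one]
  rw [h_ball, Set.encard_smul_set, (hG 1 R).cast_ncard_eq]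

/-- The measures `ξ` of property A are the uniform measures on the translates of a Følner set. -/
theorem AmenableGroup.propertyA (h : AmenableGroup G) (hG : ProperGroupMetric G) :
    PropertyA G := by
  classical
  intro R _ ε hε
  obtain ⟨F, hF, hF_le⟩ := h (hG 1 R).toFinset (ε / 2) (by positivity)
  obtain ⟨S, hS⟩ := (F.image fun f => dist f 1).bddAbove
  refine ⟨max S 1, by positivity, fun g => PMF.uniformOfFinset (g • F) hF.smul_finset,
    fun x y hxy => ?_, fun g z hz => ?_⟩
  · have h_mem : x⁻¹ * y ∈ (hG 1 R).toFinset := by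
      rw [Set.Finite.mem_toFinset, Metric.mem_closedBall, ← dist_smul x]
      simpa [dist_comm] using hxy
    have h_card : (0 : ℝ) < F.card := by exact_mod_cast hF.card_pos
    rw [tsum_abs_uniformOfFinset_sub _ _ (by simp only [Finset.card_smul_finset]),
      Finset.card_smul_finset, Finset.coe_smul_finset, Finset.coe_smul_finset,
      smul_symmDiff_smul, Set.ncard_smul_set, div_lt_iff₀ h_card]
    calc ((((x⁻¹ * y) • (F : Set G)) ∆ (F : Set G)).ncard : ℝ) ≤ ε / 2 * F.card := hF_le _ h_mem
      _ < ε * F.card := by gcongr; exact half_lt_self hε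
  · rw [PMF.support_uniformOfFinset, Finset.coe_smul_finset] at hz
    obtain ⟨f, hf, rfl⟩ := hz
    calc dist (g • f) g = dist f 1 := by simpa using dist_smul g f 1
      _ ≤ S := hS (Finset.mem_coe.2 (Finset.mem_image_of_mem _ hf))
      _ ≤ max S 1 := le_max_left S 1

end AmenableGroups

end CoarseGeometry

theorem mainTheorem1_general :
    (∀ (X : Type u) [MetricSpace X],
      (CoarseGeometry.BoundedGeometry X → CoarseGeometry.PropertyA X → CoarseGeometry.ULAmu X) ∧
      (CoarseGeometry.BoundedGeometry X →
        (CoarseGeometry.ULAmu X ↔ CoarseGeometry.ULAmuFun X)) ∧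
      (CoarseGeometry.ULAmu X ↔ CoarseGeometry.MSP X) ∧
      (CoarseGeometry.MSP X → CoarseGeometry.ONLPreHilbert.{u, v} X)) ∧
    (∀ (G : Type w) [Group G] [MetricSpace G] [IsIsometricSMul G G],
      CoarseGeometry.ProperGroupMetric G → CoarseGeometry.AmenableGroup G →
      CoarseGeometry.MSP G ∧ CoarseGeometry.ONLPreHilbert.{w, v} G) := by
  refine ⟨fun X _ => ⟨fun hX hA => hA.ulamu hX, fun hX => ⟨fun h => h.ulamuFun hX,
    fun h => h.ulamu hX⟩, ⟨fun h => h.msp, fun h => h.ulamu⟩, fun h => h.onlPreHilbert⟩, ?_⟩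
  intro G _ _ _ hG h
  have h_msp : CoarseGeometry.MSP G := ((h.propertyA hG).ulamu hG.boundedGeometry).msp
  exact ⟨h_msp, h_msp.onlPreHilbert⟩

theorem mainTheorem1 :
    (∀ (X : Type u) [MetricSpace X], CoarseGeometry.BoundedGeometry X →
      (CoarseGeometry.PropertyA X → CoarseGeometry.ULAmu X) ∧
      (CoarseGeometry.ULAmu X ↔ CoarseGeometry.ULAmuFun X) ∧
      (CoarseGeometry.ULAmu X ↔ CoarseGeometry.MSP X) ∧
      (CoarseGeometry.MSP X → CoarseGeometry.ONL.{u, v} X) ∧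
      (CoarseGeometry.PropertyA X → CoarseGeometry.ONL.{u, v} X)) ∧
    (∀ (G : Type w) [Group G] [MetricSpace G] [IsIsometricSMul G G],
      CoarseGeometry.ProperGroupMetric G → CoarseGeometry.AmenableGroup G →
      CoarseGeometry.MSP G ∧ CoarseGeometry.ONL.{w, v} G) := by
  obtain ⟨hX, hG⟩ := mainTheorem1_general.{u, v, w}
  refine ⟨fun X _ hX₀ => ?_, fun G _ _ _ hP h => (hG G hP h).imp_right (·.onl)⟩
  obtain ⟨hA, hF, hM, hO⟩ := hX X
  exact ⟨hA hX₀, hF hX₀, hM, fun h => (hO h).onl, fun h => (hO (hM.1 (hA hX₀ h))).onl⟩
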